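/- Let $n,m\ge 1$ and let $v_i(j)\in\mathbb R$ ($i\in[n]$, $j\in[m]$) be the values of $n$ agents for $m$ indivisible items, not all equal to zero; write $v_i(S)=\sum_{j\in S}v_i(j)$ for $S\subseteq[m]$. Put $$\lambda=\min\{\,v_i(S)-v_i(T)\;:\; i\in[n],\ S,T\subseteq[m],\ v_i(S)-v_i(T)>0\,\}.$$ Let $0<\varepsilon<\lambda/(2m)$, and let $\varepsilon_{ij}\in[0,\varepsilon]$ be arbitrary numbers with $\varepsilon_{ij}=0$ whenever $v_i(j)=0$. Let $\overline v$ be the instance with items $[m+1]$ and values $\overline v_i(j)=v_i(j)-\varepsilon_{ij}$ for $j\in[m]$ and $\overline v_i(m+1)=\lambda/2$, for all $i\in[n]$, and put $$\eta=\frac{\lambda}{2mn\,\max_{i\in[n],\,j\in[m+1]}|\overline v_i(j)|}.$$ For $w$ in the simplex $\Delta_{n-1}=\{w\in\mathbb R^n_{\ge0}:\sum_i w_i=1\}$, let $\mathrm{LP}(w,\eta)$ be the linear program $$\max\ \sum_{i\in[n]}\sum_{j\in[m+1]}(w_i+\eta)\,\overline v_i(j)\,x_{ij}\quad\text{subject to}\quad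 \sum_{i\in[n]}x_{ij}=1\ \ (j\in[m+1]),\qquad x_{ij}\ge0,$$ and let $\mathrm{Dual\text{-}LP}(w,\eta)$ be the program of minimizing $\sum_{j\in[m+1]}p_j$ subject to $p_j\ge(w_i+\eta)\,\overline v_i(j)$ for all $i\in[n]$, $j\in[m+1]$. An allocation $A=(A_1,\dots,A_n)$, that is, a partition of $[m+1]$ into $n$ possibly empty bundles, is called optimal for $\mathrm{LP}(w,\eta)$ if its $0/1$ indicator matrix ($x_{ij}=1$ if $j\in A_i$, and $x_{ij}=0$ otherwise) is an optimal solution of $\mathrm{LP}(w,\eta)$. **Theorem.** There is a point $w^*\in\Delta_{n-1}$ for which $\mathrm{Dual\text{-}LP}(w^*,\eta)$ has a unique optimal solution $p$, given by $p_j=\max_{i\in[n]}(w^*_i+\eta)\,\overline v_i(j)$, and such that for every agent $i\in[n]$ there is an allocation $A^{(i)}$ optimal for $\mathrm{LP}(w^*,\eta)$ in which agent $i$ has a bundle of maximum total price: $$\sum_{t\in A^{(i)}_i}p_t\;\ge\;\sum_{t\in A^{(i)}_k}p_t\qquad\text{for all }k\in[n].$$ -/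

import Mathlib

namespace FairDivision

open Finset

/-- The additive value `v(S) = ∑ j ∈ S, v(j)` of a bundle `S` of items (also used for the
price `p(S)` of a bundle under a vector `p` of prices). -/
def bundleSum {m : ℕ} (v : Fin m → ℝ) (S : Finset (Fin m)) : ℝ :=
  ∑ j ∈ S, v j

/-- The positive differences `v_i(S) - v_i(T) > 0` over all agents `i` and all bundles `S, T`. -/
def positiveGaps {n m : ℕ} (v : Fin n → Fin m → ℝ) : Set ℝ :=
  {d | 0 < d ∧ ∃ (i : Fin n) (S T : Finset (Fin m)), d = bundleSum (v i) S - bundleSum (v i) T}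

/-- The minimum possible envy `lam`: the least positive difference of values of two bundles for
one agent. The set is finite, so the infimum is a minimum whenever some `v i j` is nonzero. -/
noncomputable def lam {n m : ℕ} (v : Fin n → Fin m → ℝ) : ℝ :=
  sInf (positiveGaps v)

/-- The perturbed instance with one extra item (the last element of `Fin (m + 1)`): item `j < m`
has value `v i j - e i j` for agent `i`, and the extra item has value `lam v / 2` for everyone. -/
noncomputable def perturbed {n m : ℕ} (v e : Fin n → Fin m → ℝ) : Fin n → Fin (m + 1) → ℝ :=
  fun i => Fin.snoc (α := fun _ => ℝ) (fun j => v i j - e i j) (lam v / 2)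

/-- The constant `η = lam / (2 m n max_{i,j} |vbar_i(j)|)`. -/
noncomputable def eta {n m : ℕ} (v e : Fin n → Fin m → ℝ) : ℝ :=
  lam v / (2 * (m : ℝ) * (n : ℝ) * ⨆ q : Fin n × Fin (m + 1), |perturbed v e q.1 q.2|)

/-- Feasible points of the primal program: `∑ i, x i j = 1` for every item `j`, and `x ≥ 0`. -/
def LPFeasible {n k : ℕ} (x : Fin n → Fin k → ℝ) : Prop :=
  (∀ j, ∑ i, x i j = 1) ∧ ∀ i j, 0 ≤ x i j

/-- The objective `∑ i, ∑ j, (w i + η) u_i(j) x i j` of the primal program. -/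
def lpObjective {n k : ℕ} (u : Fin n → Fin k → ℝ) (w : Fin n → ℝ) (η : ℝ)
    (x : Fin n → Fin k → ℝ) : ℝ :=
  ∑ i, ∑ j, (w i + η) * u i j * x i j

/-- `x` is an optimal solution of the primal program `LP(w, η)` for the values `u`. -/
def IsLPOptimal {n k : ℕ} (u : Fin n → Fin k → ℝ) (w : Fin n → ℝ) (η : ℝ)
    (x : Fin n → Fin k → ℝ) : Prop :=
  LPFeasible x ∧ ∀ y, LPFeasible y → lpObjective u w η y ≤ lpObjective u w η x

/-- Feasible points of the dual program: `(w i + η) u_i(j) ≤ p j` for all `i`, `j`. -/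
def DualFeasible {n k : ℕ} (u : Fin n → Fin k → ℝ) (w : Fin n → ℝ) (η : ℝ)
    (p : Fin k → ℝ) : Prop :=
  ∀ i j, (w i + η) * u i j ≤ p j

/-- `p` is an optimal solution of the dual program: it minimizes `∑ j, p j` among the
feasible points. -/
def IsDualOptimal {n k : ℕ} (u : Fin n → Fin k → ℝ) (w : Fin n → ℝ) (η : ℝ)
    (p : Fin k → ℝ) : Prop :=
  DualFeasible u w η p ∧ ∀ q, DualFeasible u w η q → ∑ j, p j ≤ ∑ j, q j

/-- An allocation: pairwise disjoint bundles `A i` that together contain every item. -/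
def IsAllocation {n k : ℕ} (A : Fin n → Finset (Fin k)) : Prop :=
  (∀ i i', i ≠ i' → Disjoint (A i) (A i')) ∧ ∀ j, ∃ i, j ∈ A i

/-- The 0/1 point `x` that corresponds to an allocation: `x i j = 1` iff `j ∈ A i`. -/
def indicatorPoint {n k : ℕ} (A : Fin n → Finset (Fin k)) : Fin n → Fin k → ℝ :=
  fun i j => if j ∈ A i then 1 else 0

end FairDivision

namespace FairDivision

open Finset

/-! Give every item to an agent with the largest weighted value; the resulting prices are the
itemwise maxima, so LP duality makes the allocation optimal and the prices the unique dual optimum,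
however ties are broken. Let `C i` be the set of weights `w` at which some such allocation gives
agent `i` a bundle of maximum price. Each `C i` is a finite union of closed sets, and the claim is
that all of them share a point of the simplex.

This is the Knaster–Kuratowski–Mazurkiewicz lemma, once every `w` lies in some `C i` with `w i ≠ 0`
(`weight_ne_zero_of_mem_maxPriceRegion`). An agent of weight zero cannot have a dearest bundle: `η`
makes its prices tiny, and the extra item puts the bundle of an agent of largest weight ahead.

KKM is obtained combinatorially. Scarf's lemma, a parity argument on pivots, applied to a fine net
of the simplex gives an approximate common point; compactness gives the dual KKM lemma, and a choice
of auxiliary closed sets turns it into KKM. -/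

/-- If `f` maps `S` onto a set with one element less, exactly two elements of `S` can be removed
without changing the image. -/
lemma exists_pair_of_image_card {α β : Type*} [DecidableEq α] [DecidableEq β] {S : Finset α}
    {J : Finset β} {f : α → β} (hJ : S.image f = J) (hcard : #S = #J + 1) :
    ∃ x ∈ S, ∃ y ∈ S, x ≠ y ∧ f x = f y ∧ ∀ a ∈ S, J ⊆ (S.erase a).image f ↔ a = x ∨ a = y := by
  obtain ⟨x, hx, y, hy, hxy, hfxy⟩ : ∃ x ∈ S, ∃ y ∈ S, x ≠ y ∧ f x = f y :=
    exists_ne_map_eq_of_card_lt_of_maps_to (t := J) (by omega)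
      (fun a ha => hJ ▸ mem_image_of_mem f ha)
  refine ⟨x, hx, y, hy, hxy, hfxy, fun a ha => ⟨fun h => ?_, ?_⟩⟩
  · by_contra! hne
    have hinj : Set.InjOn f (S.erase a) := by
      refine card_image_iff.1 (le_antisymm card_image_le ?_)
      rw [card_erase_of_mem ha]
      have := card_le_card h
      omega
    exact hxy (hinj (by simp [hx, hne.1.symm]) (by simp [hy, hne.2.symm]) hfxy)
  · intro h b hb
    rw [← hJ, mem_image] at hb
    obtain ⟨z, hz, rfl⟩ := hb
    by_cases hza : z = a
    · subst hza
      rcases h with rfl | rfl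
      · exact mem_image.2 ⟨y, by simp [hy, hxy.symm], hfxy.symm⟩
      · exact mem_image.2 ⟨x, by simp [hx, hxy], hfxy⟩
    · exact mem_image_of_mem f (by simp [hz, hza])

/-! ### Scarf's lemma by pivoting and parity. -/

section Scarf

variable {T I R : Type*} [LinearOrder R]

/-- `(σ, D)` is dominant for the orders `r`: every `y` is, for some index `i ∈ D`, at most
every element of `σ` in the `i`-th order. -/
def IsDominant (r : I → T → R) (σ : Set T) (D : Set I) : Prop :=
  ∀ y, ∃ i ∈ D, ∀ x ∈ σ, r i y ≤ r i x

lemma IsDominant.mono {r : I → T → R} {σ σ' : Set T} {D D' : Set I} (h : IsDominant r σ D)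
    (hσ : σ' ⊆ σ) (hD : D ⊆ D') : IsDominant r σ' D' := fun y =>
  let ⟨i, hi, hy⟩ := h y
  ⟨i, hD hi, fun x hx => hy x (hσ hx)⟩

/-- The pivoting step: a dominant pair with one more index than elements, and at least one element,
can be extended to a dominant pair with equally many of both in exactly two ways. -/
lemma IsDominant.exists_two_extensions [Fintype T] [DecidableEq T] [DecidableEq I]
    {r : I → T → R} (hr : ∀ i, Function.Injective (r i)) {σ : Finset T} {D : Finset I}
    (h : IsDominant r σ D) (hσ : σ.Nonempty) (hcard : #D = #σ + 1) :
    ∃ a b : T ⊕ I, a ≠ b ∧ ∀ z : T ⊕ I,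
      (z = a ∨ z = b) ↔
        (∃ x, z = Sum.inl x ∧ x ∉ σ ∧ IsDominant r (insert x σ : Finset T) D) ∨
        (∃ k, z = Sum.inr k ∧ k ∈ D ∧ IsDominant r σ (D.erase k : Finset I)) := by
  have hmin : ∀ l, ∃ x ∈ σ, ∀ y ∈ σ, r l x ≤ r l y := fun l => exists_min_image σ (r l) hσ
  choose mn hmn hmnle using hmin
  have heqmn : ∀ l, ∀ x ∈ σ, (∀ y ∈ σ, r l x ≤ r l y) → x = mn l := fun l x hx hxy =>
    hr l (le_antisymm (hxy _ (hmn l)) (hmnle l x hx))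
  have himg : D.image mn = σ := by
    ext x
    simp only [mem_image]
    constructor
    · rintro ⟨l, -, rfl⟩; exact hmn l
    · intro hx
      obtain ⟨l, hl, hlx⟩ := h x
      exact ⟨l, hl, (heqmn l x hx hlx).symm⟩
  obtain ⟨i, hi, j, hj, hij, hmij, hrem⟩ := exists_pair_of_image_card himg hcard
  -- `M k` holds the points that only the index `k` can dominate. For `k = i` or `k = j` there is
  -- exactly one extension: insert the `r k`-largest point of `M k`, or delete `k` if `M k` is
  -- empty.
  let M : I → Finset T := fun k => univ.filter fun y => ∀ l ∈ D, l ≠ k → r l (mn l) < r l y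
  have hM : ∀ k y, y ∈ M k ↔ ∀ l ∈ D, l ≠ k → r l (mn l) < r l y := fun k y => by simp [M]
  have hMk : ∀ k y, y ∈ M k → r k y ≤ r k (mn k) := fun k y hy => by
    obtain ⟨l, hl, hly⟩ := h y
    by_cases hlk : l = k
    · exact hlk ▸ hly _ (hmn l)
    · exact absurd (hly _ (hmn l)) (not_le.2 ((hM k y).1 hy l hl hlk))
  have hMσ : ∀ k, (k = i ∨ k = j) → k ∈ D → ∀ x ∈ M k, x ∉ σ := fun k hk hkD x hx hxσ => by
    obtain ⟨l, hl, rfl⟩ := mem_image.1 ((hrem k hkD).2 hk hxσ)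
    rw [mem_erase] at hl
    exact lt_irrefl _ ((hM k _).1 hx l hl.2 hl.1)
  have hdisj : ∀ x, x ∈ M i → x ∉ M j := fun x hxi hxj => by
    obtain ⟨l, hl, hlx⟩ := h x
    have hle := hlx _ (hmn l)
    by_cases hli : l = i
    · exact absurd hle (not_le.2 ((hM j x).1 hxj l hl (hli ▸ hij)))
    · exact absurd hle (not_le.2 ((hM i x).1 hxi l hl hli))
  have hmax : ∀ k, ∃ a : T ⊕ I, ∀ z, z = a ↔
      (∃ x ∈ M k, z = Sum.inl x ∧ ∀ y ∈ M k, r k y ≤ r k x) ∨ (z = Sum.inr k ∧ M k = ∅) := by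
    intro k
    rcases (M k).eq_empty_or_nonempty with hk | hk
    · exact ⟨Sum.inr k, fun z => by simp [hk]⟩
    · obtain ⟨x, hx, hxy⟩ := exists_max_image (M k) (r k) hk
      refine ⟨Sum.inl x, fun z => ⟨fun hz => Or.inl ⟨x, hx, hz, hxy⟩, ?_⟩⟩
      rintro (⟨x', hx', rfl, hxy'⟩ | ⟨-, he⟩)
      · rw [hr k (le_antisymm (hxy _ hx') (hxy' _ hx))]
      · exact absurd he hk.ne_empty
  have hinr : ∀ k, k ∈ D → (IsDominant r σ (D.erase k : Finset I) ↔ M k = ∅) := by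
    intro k hk
    rw [eq_empty_iff_forall_notMem]
    refine forall_congr' fun y => ?_
    rw [hM]
    push Not
    constructor
    · rintro ⟨l, hl, hly⟩
      rw [mem_coe, mem_erase] at hl
      exact ⟨l, hl.2, hl.1, hly _ (hmn l)⟩
    · rintro ⟨l, hl, hlk, hly⟩
      exact ⟨l, by simp [hl, hlk], fun x hx => hly.trans (hmnle l x hx)⟩
  have hMempty : ∀ k, k ∈ D → M k = ∅ → k = i ∨ k = j := by
    intro k hk he
    refine (hrem k hk).1 fun x hx => ?_
    obtain ⟨l, hl, hlx⟩ := (hinr k hk).2 he x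
    exact mem_image.2 ⟨l, hl, (heqmn l x hx hlx).symm⟩
  have hinl : ∀ x, (x ∉ σ ∧ IsDominant r (insert x σ : Finset T) D) ↔
      ∃ k, (k = i ∨ k = j) ∧ x ∈ M k ∧ ∀ y ∈ M k, r k y ≤ r k x := by
    intro x
    constructor
    · rintro ⟨hx, hdom⟩
      -- By counting, `l` is a bijection from `insert x σ` to `D`, so `mn k` is sent to `k` for all
      -- `k ≠ l x`. Since `mn i = mn j`, one of `i`, `j` must be `l x`.
      choose l hlD hl using hdom
      have hinj : Set.InjOn l (insert x σ : Finset T) := fun y hy y' hy' hyy' =>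
        hr (l y) (le_antisymm (hl y y' hy') (hyy' ▸ hl y' y hy))
      have hsurj : (insert x σ).image l = D := by
        refine eq_of_subset_of_card_le (image_subset_iff.2 fun y _ => hlD y) ?_
        rw [card_image_of_injOn hinj, card_insert_of_notMem hx, hcard]
      have hcase : ∀ k ∈ D, k ≠ l x → l (mn k) = k := by
        intro k hk hkx
        rw [← hsurj, mem_image] at hk
        obtain ⟨y, hy, rfl⟩ := hk
        have hyσ : y ∈ σ := (mem_insert.1 hy).resolve_left (by rintro rfl; exact hkx rfl)
        rw [← heqmn (l y) y hyσ fun z hz => hl y z (by simp [hz])]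
      have hxM : x ∈ M (l x) := by
        refine (hM _ _).2 fun k hk hkx => lt_of_le_of_ne ?_ ?_
        · have := hl (mn k) x (by simp)
          rwa [hcase k hk hkx] at this
        · intro he
          exact hx (hr k he ▸ hmn k)
      refine ⟨l x, ?_, hxM, fun y hy => ?_⟩
      · by_contra! hne
        exact hij ((hcase i hi hne.1.symm).symm.trans (hmij ▸ hcase j hj hne.2.symm))
      · by_cases hk : l y = l x
        · exact hk ▸ hl y x (by simp)
        · exact absurd (hl y (mn (l y)) (by simp [hmn]))
            (not_le.2 ((hM _ _).1 hy _ (hlD y) hk))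
    · rintro ⟨k, hk, hxk, hky⟩
      have hkD : k ∈ D := by rcases hk with rfl | rfl <;> assumption
      refine ⟨hMσ k hk hkD x hxk, fun y => ?_⟩
      by_cases hy : y ∈ M k
      · refine ⟨k, hkD, fun z hz => ?_⟩
        rcases mem_insert.1 hz with rfl | hz
        · exact hky y hy
        · exact (hMk k y hy).trans (hmnle k z hz)
      · rw [hM] at hy
        push Not at hy
        obtain ⟨l, hl, hlk, hly⟩ := hy
        refine ⟨l, hl, fun z hz => ?_⟩
        rcases mem_insert.1 hz with rfl | hz
        · exact hly.trans ((hM _ _).1 hxk l hl hlk).le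
        · exact hly.trans (hmnle l z hz)
  obtain ⟨a, ha⟩ := hmax i
  obtain ⟨b, hb⟩ := hmax j
  refine ⟨a, b, ?_, fun z => ?_⟩
  · rintro rfl
    rcases (ha a).1 rfl with ⟨x, hx, rfl, -⟩ | ⟨rfl, -⟩
    · rcases (hb _).1 rfl with ⟨x', hx', he, -⟩ | ⟨he, -⟩
      · exact hdisj x hx (Sum.inl.inj he ▸ hx')
      · simp at he
    · rcases (hb _).1 rfl with ⟨x', hx', he, -⟩ | ⟨he, -⟩
      · simp at he
      · exact hij (Sum.inr.inj he)
  · rw [ha, hb]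
    constructor
    · rintro ((⟨x, hx, rfl, hy⟩ | ⟨rfl, he⟩) | (⟨x, hx, rfl, hy⟩ | ⟨rfl, he⟩))
      · exact Or.inl ⟨x, rfl, (hinl x).2 ⟨i, Or.inl rfl, hx, hy⟩⟩
      · exact Or.inr ⟨i, rfl, hi, (hinr i hi).2 he⟩
      · exact Or.inl ⟨x, rfl, (hinl x).2 ⟨j, Or.inr rfl, hx, hy⟩⟩
      · exact Or.inr ⟨j, rfl, hj, (hinr j hj).2 he⟩
    · rintro (⟨x, rfl, hx⟩ | ⟨k, rfl, hk, hdom⟩)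
      · obtain ⟨k, rfl | rfl, hxk, hy⟩ := (hinl x).1 hx
        · exact Or.inl (Or.inl ⟨x, hxk, rfl, hy⟩)
        · exact Or.inr (Or.inl ⟨x, hxk, rfl, hy⟩)
      · have he := (hinr k hk).1 hdom
        rcases hMempty k hk he with rfl | rfl
        · exact Or.inl (Or.inr ⟨rfl, he⟩)
        · exact Or.inr (Or.inr ⟨rfl, he⟩)

/-- **Scarf's lemma**: for every colouring `c` of a finite nonempty set `T` with linear orders
indexed by `I` there is a dominant pair `(σ, D)` in which every index of `D` is a colour on `σ`. -/
theorem exists_isDominant_colorful [Fintype T] [DecidableEq T] [Nonempty T] [Fintype I]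
    [DecidableEq I] [Nonempty I] {r : I → T → R} (hr : ∀ i, Function.Injective (r i)) (c : T → I) :
    ∃ (σ : Finset T) (D : Finset I), IsDominant r σ D ∧ D ⊆ σ.image c := by
  classical
  obtain ⟨i₀⟩ := ‹Nonempty I›
  -- A set `S` encodes the pair of `σ = S.toLeft` and `D = S.toRightᶜ`, so inserting `Sum.inr k`
  -- deletes `k` from `D`. With the colour `k` on `Sum.inr k`, an index of `D` that occurs as a
  -- colour of `S` must come from `σ`.
  let f : T ⊕ I → I := Sum.elim c id
  let Dom : Finset (T ⊕ I) → Prop := fun S => IsDominant r S.toLeft (S.toRightᶜ : Finset I)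
  have hDom : ∀ {S S'}, S ⊆ S' → Dom S' → Dom S := fun hSS h =>
    h.mono (by exact_mod_cast toLeft_subset_toLeft hSS)
      (by exact_mod_cast compl_subset_compl.2 (toRight_subset_toRight hSS))
  let J : Finset I := univ.erase i₀
  have hJ : #J + 1 = Fintype.card I := by
    simp only [J, card_erase_of_mem (mem_univ i₀), card_univ]
    have := Fintype.card_pos_iff.2 ⟨i₀⟩
    omega
  let rooms := univ.filter fun S : Finset (T ⊕ I) => Dom S ∧ #S = Fintype.card I ∧ J ⊆ S.image f
  let doors := univ.filter fun S : Finset (T ⊕ I) =>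
    Dom S ∧ #S + 1 = Fintype.card I ∧ J ⊆ S.image f
  have hrooms : ∀ S, S ∈ rooms ↔ Dom S ∧ #S = Fintype.card I ∧ J ⊆ S.image f := by simp [rooms]
  have hdoors : ∀ S, S ∈ doors ↔ Dom S ∧ #S + 1 = Fintype.card I ∧ J ⊆ S.image f := by
    simp [doors]
  by_cases hcol : ∃ S ∈ rooms, i₀ ∈ S.image f
  · obtain ⟨S, hS, hi₀⟩ := hcol
    obtain ⟨hSD, -, hSJ⟩ := (hrooms S).1 hS
    refine ⟨S.toLeft, S.toRightᶜ, hSD, fun i hi => ?_⟩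
    have hiS : i ∈ S.image f := by
      by_cases h : i = i₀
      · exact h ▸ hi₀
      · exact hSJ (by simp [J, h])
    obtain ⟨x | k, hx, rfl⟩ := mem_image.1 hiS
    · exact mem_image.2 ⟨x, by simpa using hx, rfl⟩
    · simp [f, hx] at hi
  push Not at hcol
  exfalso
  have hroom2 : ∀ S ∈ rooms, #(bipartiteAbove (fun S τ => τ ⊆ S) doors S) = 2 := by
    intro S hS
    have hSi := hcol S hS
    obtain ⟨hSD, hSc, hSJ⟩ := (hrooms S).1 hS
    have himg : S.image f = J := by
      refine Subset.antisymm (fun i hi => ?_) hSJ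
      simp only [J, mem_erase, mem_univ, and_true]
      rintro rfl
      exact hSi hi
    obtain ⟨x, hx, y, hy, hxy, -, hrem⟩ := exists_pair_of_image_card himg (by omega)
    have hset : bipartiteAbove (fun S τ => τ ⊆ S) doors S = {S.erase x, S.erase y} := by
      ext τ
      rw [mem_bipartiteAbove, hdoors, mem_insert, mem_singleton]
      constructor
      · rintro ⟨⟨-, hτc, hτJ⟩, hτS⟩
        obtain ⟨a, ha, rfl⟩ := exists_eq_insert_iff.2 ⟨hτS, by omega⟩
        have := (hrem a (mem_insert_self _ _)).1 (by rwa [erase_insert ha])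
        rcases this with rfl | rfl
        · left; rw [erase_insert ha]
        · right; rw [erase_insert ha]
      · have key : ∀ a ∈ S, (a = x ∨ a = y) → (Dom (S.erase a) ∧ #(S.erase a) + 1 =
            Fintype.card I ∧ J ⊆ (S.erase a).image f) ∧ S.erase a ⊆ S := fun a ha h =>
          ⟨⟨hDom (erase_subset _ _) hSD, by rw [card_erase_add_one ha, hSc], (hrem a ha).2 h⟩,
            erase_subset _ _⟩
        rintro (rfl | rfl)
        · exact key _ hx (Or.inl rfl)
        · exact key _ hy (Or.inr rfl)
    rw [hset, card_pair]
    exact fun h => hxy ((erase_inj S hx).1 h)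
  have hext : ∀ τ ∈ doors, ∀ S, S ∈ bipartiteBelow (fun S τ => τ ⊆ S) rooms τ ↔
      ∃ a, S = insert a τ ∧ a ∉ τ ∧ Dom (insert a τ) := by
    intro τ hτ S
    obtain ⟨hτD, hτc, hτJ⟩ := (hdoors τ).1 hτ
    rw [mem_bipartiteBelow, hrooms]
    constructor
    · rintro ⟨⟨hSD, hSc, -⟩, hτS⟩
      obtain ⟨a, ha, rfl⟩ := exists_eq_insert_iff.2 ⟨hτS, by omega⟩
      exact ⟨a, rfl, ha, hSD⟩
    · rintro ⟨a, rfl, ha, hD⟩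
      exact ⟨⟨hD, by rw [card_insert_of_notMem ha, hτc],
        hτJ.trans (image_subset_image (subset_insert _ _))⟩, subset_insert _ _⟩
  have hcards : ∀ τ : Finset (T ⊕ I), #τ + 1 = Fintype.card I →
      #(τ.toRightᶜ) = #τ.toLeft + 1 := fun τ hτ => by
    have h1 := card_toLeft_add_card_toRight (u := τ)
    have h2 := card_compl_add_card τ.toRight
    omega
  -- The only door with `σ` empty, where the pivoting lemma does not apply: here `D = {i₀}`, and the
  -- sole extension inserts the `r i₀`-largest point.
  let τ₀ : Finset (T ⊕ I) := J.map Function.Embedding.inr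
  have hleft₀ : τ₀.toLeft = ∅ := by ext; simp [τ₀]
  have hright₀ : τ₀.toRightᶜ = {i₀} := by ext; simp [τ₀, J]
  have hτ₀ : τ₀ ∈ doors := by
    rw [hdoors]
    refine ⟨fun y => ⟨i₀, by simp [hright₀], by simp [hleft₀]⟩, by simp [τ₀, hJ], fun i hi => ?_⟩
    exact mem_image.2 ⟨Sum.inr i, by simpa [τ₀] using hi, rfl⟩
  have hdoor1 : #(bipartiteBelow (fun S τ => τ ⊆ S) rooms τ₀) = 1 := by
    obtain ⟨x, -, hx⟩ := exists_max_image (univ : Finset T) (r i₀) univ_nonempty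
    rw [card_eq_one]
    refine ⟨insert (Sum.inl x) τ₀, ?_⟩
    ext S
    rw [hext _ hτ₀, mem_singleton]
    constructor
    · rintro ⟨a, rfl, ha, hD⟩
      rcases a with y | k
      · simp only [Dom, toLeft_insert_inl, toRight_insert_inl, hleft₀, hright₀] at hD
        obtain ⟨i, hi, hxy⟩ := hD x
        simp only [coe_singleton, Set.mem_singleton_iff] at hi
        subst hi
        have := hxy y (by simp)
        rw [hr i (le_antisymm (hx y (mem_univ _)) this)]
      · have hk : k = i₀ := by by_contra h; simp [τ₀, J, h] at ha
        obtain ⟨i, hi, -⟩ := hD x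
        have : i ≠ k ∧ i ∈ τ₀.toRightᶜ := by simpa [and_comm] using hi
        rw [hright₀, mem_singleton] at this
        exact absurd (this.2.trans hk.symm) this.1
    · rintro rfl
      refine ⟨Sum.inl x, rfl, by simp [τ₀], fun y => ⟨i₀, ?_, ?_⟩⟩
      · simp [hright₀]
      · simp [hleft₀, hx]
  have hdoor2 : ∀ τ ∈ doors.erase τ₀, #(bipartiteBelow (fun S τ => τ ⊆ S) rooms τ) = 2 := by
    intro τ hτ
    obtain ⟨hne, hτd⟩ := mem_erase.1 hτ
    obtain ⟨hτD, hτc, hτJ⟩ := (hdoors τ).1 hτd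
    have hσ : τ.toLeft.Nonempty := by
      rw [nonempty_iff_ne_empty]
      intro he
      refine hne (eq_of_subset_of_card_le (fun a ha => ?_) (by simp [τ₀]; omega)).symm
      obtain ⟨k, hk, rfl⟩ := mem_map.1 ha
      obtain ⟨x | l, hx, hxk⟩ := mem_image.1 (hτJ hk)
      · exact absurd (mem_toLeft.2 hx) (by simp [he])
      · obtain rfl : l = k := hxk
        exact hx
    obtain ⟨a, b, hab, hz⟩ := hτD.exists_two_extensions hr hσ (hcards τ hτc)
    have hz' : ∀ z, (z = a ∨ z = b) ↔ z ∉ τ ∧ Dom (insert z τ) := by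
      intro z
      rw [hz]
      rcases z with x | k
      · simp [Dom]
      · have : (insert k τ.toRight)ᶜ = (τ.toRightᶜ).erase k := by ext; simp
        simp only [Dom, toLeft_insert_inr, toRight_insert_inr, this]
        simp
    have hset : bipartiteBelow (fun S τ => τ ⊆ S) rooms τ = {insert a τ, insert b τ} := by
      ext S
      rw [hext τ hτd, mem_insert, mem_singleton]
      constructor
      · rintro ⟨z, rfl, h⟩
        rcases (hz' z).2 h with rfl | rfl
        · exact Or.inl rfl
        · exact Or.inr rfl
      · rintro (rfl | rfl)
        · exact ⟨a, rfl, (hz' a).1 (Or.inl rfl)⟩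
        · exact ⟨b, rfl, (hz' b).1 (Or.inr rfl)⟩
    rw [hset, card_pair]
    exact fun h => hab ((insert_inj ((hz' a).1 (Or.inl rfl)).1).1 h)
  have hcount := sum_card_bipartiteAbove_eq_sum_card_bipartiteBelow (s := rooms) (t := doors)
    (fun S τ => τ ⊆ S)
  -- Incidences number `2 * #rooms` by rooms and `1 + 2 * (#doors - 1)` by doors: a parity
  -- contradiction.
  rw [sum_congr rfl hroom2, ← add_sum_erase _ _ hτ₀, sum_congr rfl hdoor2, hdoor1] at hcount
  simp only [sum_const, smul_eq_mul] at hcount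
  omega

end Scarf

/-! ### From Scarf's lemma to covering theorems on the simplex. -/

section KKM

variable {I : Type*} [Fintype I]

/-- An approximate form of `exists_mem_iInter_of_cover`. -/
lemma exists_mem_stdSimplex_dist_le [Nonempty I] {F : I → Set (I → ℝ)}
    (hcover : ∀ w ∈ stdSimplex ℝ I, ∃ i, w ∈ F i) {δ : ℝ} (hδ : 0 < δ) :
    ∃ w ∈ stdSimplex ℝ I, ∀ i, (∃ z ∈ F i, dist w z ≤ δ) ∨ w i ≤ δ := by
  classical
  have hn0 : (0 : ℝ) < Fintype.card I := by exact_mod_cast Fintype.card_pos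
  obtain ⟨t, hts, htfin, htnet⟩ := (isCompact_stdSimplex ℝ I).finite_cover_balls
    (show 0 < δ / Fintype.card I by positivity)
  have : Fintype t := htfin.fintype
  have hnet : ∀ z ∈ stdSimplex ℝ I, ∃ y : t, ∀ i, z i - y.1 i < δ / Fintype.card I := by
    intro z hz
    obtain ⟨y, hy, hzy⟩ := Set.mem_iUnion₂.1 (htnet hz)
    refine ⟨⟨y, hy⟩, fun i => ?_⟩
    exact (le_abs_self _).trans_lt ((dist_le_pi_dist z y i).trans_lt (Metric.mem_ball.1 hzy))
  have : Nonempty t := by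
    obtain ⟨i⟩ := ‹Nonempty I›
    exact ⟨(hnet _ (single_mem_stdSimplex ℝ i)).choose⟩
  choose c hc using fun y : t => hcover y.1 (hts y.2)
  -- The enumeration of the net breaks ties between equal coordinates, making the orders injective.
  let r : I → t → ℝ ×ₗ Fin (Fintype.card t) := fun i y => toLex (y.1 i, Fintype.equivFin t y)
  have hr : ∀ i, Function.Injective (r i) := fun i y y' h =>
    (Fintype.equivFin t).injective (congrArg Prod.snd (toLex.injective h))
  have hrle : ∀ {i y y'}, r i y ≤ r i y' → y.1 i ≤ y'.1 i := fun h => by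
    rcases Prod.Lex.toLex_le_toLex.1 h with h | h
    · exact h.le
    · exact h.1.le
  obtain ⟨σ, D, hdom, hcol⟩ := exists_isDominant_colorful hr c
  have hD : D.Nonempty := by
    obtain ⟨i, hi, -⟩ := hdom (Classical.arbitrary t)
    exact ⟨i, hi⟩
  have hσ : σ.Nonempty := by simpa using hD.mono hcol
  choose mn hmn hmnle using fun i => exists_min_image σ (fun y => y.1 i) hσ
  have hDpos : (0 : ℝ) < #D := by exact_mod_cast hD.card_pos
  have hDle : (#D : ℝ) ≤ Fintype.card I := by exact_mod_cast card_le_univ D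
  -- Otherwise raise each minimum over `D` by `s` and put 0 elsewhere. A net point near the
  -- resulting `z` exceeds the minima of `σ` in every order of `D`, against dominance. Hence `σ` is
  -- small: its points nearly agree on `D` and nearly vanish off it.
  have hsum : 1 - δ ≤ ∑ i ∈ D, (mn i).1 i := by
    by_contra! hlt
    set s := (1 - ∑ i ∈ D, (mn i).1 i) / #D with hs
    have hsδ : δ / Fintype.card I < s := by
      rw [hs]
      calc δ / Fintype.card I ≤ δ / #D := by gcongr
        _ < _ := by gcongr; linarith
    have hs0 : 0 < s := lt_trans (by positivity) hsδ
    let z : I → ℝ := fun i => if i ∈ D then (mn i).1 i + s else 0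
    have hz : z ∈ stdSimplex ℝ I := by
      refine ⟨fun i => ?_, ?_⟩
      · have := (hts (mn i).2).1 i
        simp only [z]
        split_ifs
        · positivity
        · exact le_rfl
      · simp only [z, sum_ite_mem, univ_inter, sum_add_distrib, sum_const, nsmul_eq_mul, hs]
        field_simp
        ring
    obtain ⟨y, hy⟩ := hnet z hz
    obtain ⟨i, hi, hiy⟩ := hdom y
    have h1 := hrle (hiy _ (hmn i))
    have h2 := hy i
    simp only [z, if_pos (mem_coe.1 hi)] at h2
    linarith
  have hin : ∀ x ∈ σ, ∀ i ∈ D, x.1 i ≤ (mn i).1 i + δ := by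
    intro x hx i hi
    have h1 : x.1 i - (mn i).1 i ≤ ∑ k ∈ D, (x.1 k - (mn k).1 k) :=
      single_le_sum (f := fun k => x.1 k - (mn k).1 k)
        (fun k _ => sub_nonneg.2 (hmnle k x hx)) hi
    have h2 : ∑ k ∈ D, x.1 k ≤ 1 := (hts x.2).2 ▸
      sum_le_univ_sum_of_nonneg (hts x.2).1
    rw [sum_sub_distrib] at h1
    linarith
  have hout : ∀ x ∈ σ, ∀ i ∉ D, x.1 i ≤ δ := by
    intro x hx i hi
    have h1 : x.1 i ≤ ∑ k ∈ Dᶜ, x.1 k :=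
      single_le_sum (f := fun k => x.1 k) (fun k _ => (hts x.2).1 k) (by simpa using hi)
    have h2 := sum_add_sum_compl D x.1
    rw [(hts x.2).2] at h2
    have h3 : ∑ k ∈ D, (mn k).1 k ≤ ∑ k ∈ D, x.1 k := sum_le_sum fun k _ => hmnle k x hx
    linarith
  obtain ⟨w, hw⟩ := hσ
  refine ⟨w.1, hts w.2, fun i => ?_⟩
  by_cases hi : i ∈ D
  · left
    obtain ⟨x, hx, rfl⟩ := mem_image.1 (hcol hi)
    refine ⟨x.1, hc x, (dist_pi_le_iff hδ.le).2 fun k => ?_⟩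
    rw [Real.dist_eq, abs_sub_le_iff]
    by_cases hk : k ∈ D
    · have h1 := hin w hw k hk
      have h2 := hin x hx k hk
      have h3 := hmnle k w hw
      have h4 := hmnle k x hx
      constructor <;> linarith
    · have h1 := hout w hw k hk
      have h2 := hout x hx k hk
      have h3 := (hts w.2).1 k
      have h4 := (hts x.2).1 k
      constructor <;> linarith
  · exact Or.inr (hout w hw i hi)

/-- The dual of the Knaster–Kuratowski–Mazurkiewicz lemma: if closed sets `F i` cover the simplex
and `F i` contains the face opposite to the vertex `i`, then they have a common point. -/
theorem exists_mem_iInter_of_cover [Nonempty I] {F : I → Set (I → ℝ)}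
    (hclosed : ∀ i, IsClosed (F i)) (hcover : ∀ w ∈ stdSimplex ℝ I, ∃ i, w ∈ F i)
    (hface : ∀ w ∈ stdSimplex ℝ I, ∀ i, w i = 0 → w ∈ F i) :
    ∃ w ∈ stdSimplex ℝ I, ∀ i, w ∈ F i := by
  classical
  -- `Metric.infDist` to the empty set is 0, so zero distance gives membership only for nonempty
  -- sets.
  have hne : ∀ i, (F i).Nonempty := by
    intro i
    by_cases h : ∃ k, k ≠ i
    · obtain ⟨k, hk⟩ := h
      exact ⟨_, hface _ (single_mem_stdSimplex ℝ k) i (by simp [hk.symm])⟩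
    · push Not at h
      obtain ⟨k, hk⟩ := hcover _ (single_mem_stdSimplex ℝ i)
      exact ⟨_, h k ▸ hk⟩
  -- The approximate points make the minimum of `h` zero; at a minimizer each `i` has `w ∈ F i` by
  -- closedness or `w i = 0`, where `hface` applies.
  let h : (I → ℝ) → ℝ := fun w => ∑ i, min (Metric.infDist w (F i)) (w i)
  have hcont : Continuous h := continuous_finsetSum _ fun i _ =>
    (Metric.continuous_infDist_pt _).min (continuous_apply i)
  obtain ⟨w, hw, hmin⟩ := (isCompact_stdSimplex ℝ I).exists_isMinOn
    ⟨_, single_mem_stdSimplex ℝ (Classical.arbitrary I)⟩ hcont.continuousOn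
  have hnonneg : ∀ i, 0 ≤ min (Metric.infDist w (F i)) (w i) := fun i =>
    le_min Metric.infDist_nonneg (hw.1 i)
  have hle : h w ≤ 0 := by
    refine le_of_forall_pos_le_add fun ε hε => ?_
    have hn0 : (0 : ℝ) < Fintype.card I := by exact_mod_cast Fintype.card_pos
    obtain ⟨z, hz, hzF⟩ := exists_mem_stdSimplex_dist_le hcover
      (show 0 < ε / Fintype.card I by positivity)
    calc h w ≤ h z := hmin hz
      _ ≤ ∑ _i : I, ε / Fintype.card I := sum_le_sum fun i _ => by
          rcases hzF i with ⟨y, hy, hzy⟩ | hi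
          · exact (min_le_left _ _).trans ((Metric.infDist_le_dist_of_mem hy).trans hzy)
          · exact (min_le_right _ _).trans hi
      _ = 0 + ε := by simp; field_simp
  have hzero := (sum_eq_zero_iff_of_nonneg fun i _ => hnonneg i).1
    (le_antisymm hle (sum_nonneg fun i _ => hnonneg i))
  refine ⟨w, hw, fun i => ?_⟩
  rcases min_choice (Metric.infDist w (F i)) (w i) with hi | hi
  · exact ((hclosed i).mem_iff_infDist_zero (hne i)).2 (hi ▸ hzero i (mem_univ i))
  · exact hface w hw i (hi ▸ hzero i (mem_univ i))

/-- The **Knaster–Kuratowski–Mazurkiewicz lemma**: if every point `w` of the simplex lies in one of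
the closed sets `C i` with `w i ≠ 0`, then these sets have a common point. -/
theorem knaster_kuratowski_mazurkiewicz [Nonempty I] {C : I → Set (I → ℝ)}
    (hclosed : ∀ i, IsClosed (C i)) (hcover : ∀ w ∈ stdSimplex ℝ I, ∃ i, w i ≠ 0 ∧ w ∈ C i) :
    ∃ w ∈ stdSimplex ℝ I, ∀ i, w ∈ C i := by
  classical
  have hne : ∀ i, (C i).Nonempty := by
    intro i
    obtain ⟨k, hk, hkC⟩ := hcover _ (single_mem_stdSimplex ℝ i)
    obtain rfl : k = i := by by_contra h; simp [h] at hk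
    exact ⟨_, hkC⟩
  let d : I → (I → ℝ) → ℝ := fun i w => Metric.infDist w (C i)
  have hd : ∀ i, Continuous (d i) := fun i => Metric.continuous_infDist_pt _
  have hd0 : ∀ i w, 0 ≤ d i w := fun i w => Metric.infDist_nonneg
  have hsplit : ∀ w ∈ stdSimplex ℝ I, ∑ i, w i * ∑ k, d k w = ∑ k, d k w := fun w hw => by
    rw [← sum_mul, hw.2, one_mul]
  -- Both sides of the defining inequalities sum to `∑ k, d k w`, so they cannot all fail, and at a
  -- common point all are equalities. An `i` with `w i ≠ 0` and `d i w = 0` then forces every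
  -- distance to vanish.
  obtain ⟨w, hw, hwF⟩ := exists_mem_iInter_of_cover (F := fun i => {w | w i * ∑ k, d k w ≤ d i w})
    (fun i => isClosed_le ((continuous_apply i).mul (continuous_finsetSum _ fun k _ => hd k))
      (hd i))
    (fun w hw => by
      by_contra! hlt
      simp only [Set.mem_ofPred_eq, not_le] at hlt
      have := sum_lt_sum_of_nonempty (s := univ) univ_nonempty fun i _ => hlt i
      rw [hsplit w hw] at this
      exact lt_irrefl _ this)
    (fun w hw i hi => by simp [hi, hd0])
  refine ⟨w, hw, ?_⟩
  have heq := (sum_eq_sum_iff_of_le fun i _ => hwF i).1 (hsplit w hw)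
  obtain ⟨i, hi, hiC⟩ := hcover w hw
  have hi0 : d i w = 0 := Metric.infDist_zero_of_mem hiC
  have hsum : ∑ k, d k w = 0 := by
    have := heq i (mem_univ i)
    rw [hi0] at this
    exact (mul_eq_zero.1 this).resolve_left hi
  intro k
  exact ((hclosed k).mem_iff_infDist_zero (hne k)).2
    ((sum_eq_zero_iff_of_nonneg fun k _ => hd0 k w).1 hsum k (mem_univ k))

end KKM

/-! ### Price-maximal bundles as closed regions of weights. -/

section Assignments

variable {n k : ℕ}

/-- The price of item `j` when every item `j` is assigned to agent `A j`. -/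
def assignmentPrice (u : Fin n → Fin k → ℝ) (η : ℝ) (A : Fin k → Fin n) (w : Fin n → ℝ)
    (j : Fin k) : ℝ :=
  (w (A j) + η) * u (A j) j

/-- The points `w` at which the assignment `A` maximizes the weighted value of every item and
agent `i` has a bundle of maximum price. -/
def maxPriceRegion (u : Fin n → Fin k → ℝ) (η : ℝ) (A : Fin k → Fin n) (i : Fin n) :
    Set (Fin n → ℝ) :=
  {w | (∀ j l, (w l + η) * u l j ≤ assignmentPrice u η A w j) ∧
    ∀ l, bundleSum (assignmentPrice u η A w) {j | A j = l} ≤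
      bundleSum (assignmentPrice u η A w) {j | A j = i}}

lemma isClosed_maxPriceRegion (u : Fin n → Fin k → ℝ) (η : ℝ) (A : Fin k → Fin n) (i : Fin n) :
    IsClosed (maxPriceRegion u η A i) := by
  have hprice : ∀ j, Continuous fun w => assignmentPrice u η A w j := fun j => by
    unfold assignmentPrice
    fun_prop
  have hsum : ∀ S, Continuous fun w => bundleSum (assignmentPrice u η A w) S := fun S =>
    continuous_finsetSum _ fun j _ => hprice j
  have : maxPriceRegion u η A i =
      (⋂ j, ⋂ l, {w | (w l + η) * u l j ≤ assignmentPrice u η A w j}) ∩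
      ⋂ l, {w | bundleSum (assignmentPrice u η A w) {j | A j = l} ≤
        bundleSum (assignmentPrice u η A w) {j | A j = i}} := by
    ext w
    simp [maxPriceRegion]
  rw [this]
  refine (isClosed_iInter fun j => isClosed_iInter fun l => ?_).inter
    (isClosed_iInter fun l => isClosed_le (hsum _) (hsum _))
  exact isClosed_le (by fun_prop) (hprice j)

lemma exists_mem_maxPriceRegion [Nonempty (Fin n)] (u : Fin n → Fin k → ℝ) (η : ℝ)
    (w : Fin n → ℝ) : ∃ A i, w ∈ maxPriceRegion u η A i := by
  choose A hA using fun j => Finite.exists_max fun i => (w i + η) * u i j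
  obtain ⟨i, hi⟩ := Finite.exists_max fun i =>
    bundleSum (assignmentPrice u η A w) {j | A j = i}
  exact ⟨A, i, hA, hi⟩

/-- With a positive common item that outweighs the prices of agents of weight zero, an agent with a
bundle of maximum price has nonzero weight. -/
lemma weight_ne_zero_of_mem_maxPriceRegion {m : ℕ} (hm : 0 < m) (hn : 0 < n)
    {u : Fin n → Fin (m + 1) → ℝ} {L η : ℝ} (hL : 0 < L) (hη : 0 < η)
    (hlast : ∀ i, u i (Fin.last m) = L / 2) (hbound : ∀ i j, η * |u i j| ≤ L / (2 * m * n))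
    {w : Fin n → ℝ} (hw : w ∈ stdSimplex ℝ (Fin n)) {A : Fin (m + 1) → Fin n} {i : Fin n}
    (h : w ∈ maxPriceRegion u η A i) : w i ≠ 0 := by
  intro hi
  have hm' : (0 : ℝ) < m := by exact_mod_cast hm
  have hn' : (0 : ℝ) < n := by exact_mod_cast hn
  obtain ⟨hopt, hmax⟩ := h
  set k := A (Fin.last m) with hk
  -- The extra item has the same positive value for everyone, so its owner `k` has the largest
  -- weight, at least `1 / n`.
  have hwk : 1 ≤ n * w k := by
    have hle : ∀ l, w l ≤ w k := fun l => by
      have := hopt (Fin.last m) l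
      rw [assignmentPrice, hlast, hlast, ← hk] at this
      have := le_of_mul_le_mul_right this (by positivity)
      linarith
    calc (1 : ℝ) = ∑ l, w l := hw.2.symm
      _ ≤ ∑ _l : Fin n, w k := sum_le_sum fun l _ => hle l
      _ = n * w k := by simp
  have hki : k ≠ i := by
    rintro h
    rw [h, hi] at hwk
    norm_num at hwk
  -- As `w i = 0`, an item owned by `i` has price `η * u i j`, and one owned by `k` has price at
  -- least that, possibly negative. So each of the `m` ordinary items helps `i` against `k` by at
  -- most `L / (2 * m * n)`.
  have hitem : ∀ j : Fin m,
      (if A j.castSucc = i then assignmentPrice u η A w j.castSucc else 0) -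
        (if A j.castSucc = k then assignmentPrice u η A w j.castSucc else 0) ≤
          L / (2 * m * n) := by
    intro j
    have hb := hbound i j.castSucc
    rw [← abs_of_pos hη, ← abs_mul] at hb
    obtain ⟨hb1, hb2⟩ := abs_le.1 hb
    by_cases h1 : A j.castSucc = i
    · rw [if_pos h1, if_neg (h1 ▸ hki.symm), assignmentPrice, h1, hi]
      linarith
    · by_cases h2 : A j.castSucc = k
      · have := hopt j.castSucc i
        rw [hi] at this
        rw [if_neg h1, if_pos h2]
        linarith
      · rw [if_neg h1, if_neg h2, sub_zero]
        positivity
  have hle := hmax k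
  rw [bundleSum, bundleSum, sum_filter, sum_filter, Fin.sum_univ_castSucc, Fin.sum_univ_castSucc,
    if_pos hk.symm, if_neg (hk ▸ hki), assignmentPrice, ← hk, hlast] at hle
  have hsum := sum_le_sum fun j (_ : j ∈ (univ : Finset (Fin m))) => hitem j
  rw [sum_sub_distrib] at hsum
  have hconst : ∑ _j : Fin m, L / (2 * m * n) = L / (2 * n) := by
    simp
    field_simp
  -- The price of the extra item exceeds the total gain of `i` on ordinary items; strictness comes
  -- from `η > 0`.
  have hkey : L / (2 * n) < (w k + η) * (L / 2) := by
    rw [div_lt_iff₀ (by positivity)]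
    have : 0 < n * η * L := by positivity
    nlinarith
  linarith

/-- A common point of the regions, for all agents. -/
lemma exists_forall_mem_maxPriceRegion [Nonempty (Fin n)] {u : Fin n → Fin k → ℝ} {η : ℝ}
    (h : ∀ w ∈ stdSimplex ℝ (Fin n), ∀ A i, w ∈ maxPriceRegion u η A i → w i ≠ 0) :
    ∃ w ∈ stdSimplex ℝ (Fin n), ∀ i, ∃ A, w ∈ maxPriceRegion u η A i := by
  obtain ⟨w, hw, hwC⟩ := knaster_kuratowski_mazurkiewicz
    (C := fun i => ⋃ A, maxPriceRegion u η A i)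
    (fun i => isClosed_iUnion_of_finite fun A => isClosed_maxPriceRegion u η A i)
    (fun w hw => by
      obtain ⟨A, i, hA⟩ := exists_mem_maxPriceRegion u η w
      exact ⟨i, h w hw A i hA, Set.mem_iUnion.2 ⟨A, hA⟩⟩)
  exact ⟨w, hw, fun i => Set.mem_iUnion.1 (hwC i)⟩

end Assignments

/-! ### Duality for the assignment program. -/

section LinearPrograms

variable {n k : ℕ} {u : Fin n → Fin k → ℝ} {w : Fin n → ℝ} {η : ℝ} {p : Fin k → ℝ}

lemma lpObjective_le_of_dualFeasible (hp : DualFeasible u w η p) {x : Fin n → Fin k → ℝ}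
    (hx : LPFeasible x) : lpObjective u w η x ≤ ∑ j, p j := by
  rw [lpObjective, sum_comm]
  refine sum_le_sum fun j _ => ?_
  calc ∑ i, (w i + η) * u i j * x i j ≤ ∑ i, p j * x i j :=
        sum_le_sum fun i _ => mul_le_mul_of_nonneg_right (hp i j) (hx.2 i j)
    _ = p j := by rw [← mul_sum, hx.1 j, mul_one]

lemma isAllocation_fibers (A : Fin k → Fin n) :
    IsAllocation fun i => ({j | A j = i} : Finset (Fin k)) := by
  refine ⟨fun i i' hii' => disjoint_left.2 fun j hj hj' => ?_, fun j => ⟨A j, by simp⟩⟩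
  simp only [mem_filter, mem_univ, true_and] at hj hj'
  exact hii' (hj.symm.trans hj')

/-- The objective at the indicator point equals the sum of the prices, so weak duality is attained.
-/
lemma isLPOptimal_fibers {A : Fin k → Fin n}
    (hA : DualFeasible u w η (assignmentPrice u η A w)) :
    IsLPOptimal u w η (indicatorPoint fun i => ({j | A j = i} : Finset (Fin k))) := by
  refine ⟨⟨fun j => by simp [indicatorPoint], fun i j => ?_⟩, fun y hy => ?_⟩
  · rw [indicatorPoint]
    split_ifs <;> norm_num
  · refine (lpObjective_le_of_dualFeasible hA hy).trans_eq ?_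
    rw [lpObjective, sum_comm]
    simp [indicatorPoint, assignmentPrice]

/-- The dual decouples over items: each `p j` is the least feasible price of `j`, so a feasible `q`
with the same total agrees with `p` at every item. -/
lemma isDualOptimal_of_isGreatest
    (hp : ∀ j, IsGreatest (Set.range fun i => (w i + η) * u i j) (p j)) :
    IsDualOptimal u w η p ∧ ∀ q, IsDualOptimal u w η q → q = p := by
  have hfeas : DualFeasible u w η p := fun i j => (hp j).2 ⟨i, rfl⟩
  have hle : ∀ q, DualFeasible u w η q → ∀ j, p j ≤ q j := fun q hq j => by
    obtain ⟨i, hi⟩ := (hp j).1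
    exact hi ▸ hq i j
  refine ⟨⟨hfeas, fun q hq => sum_le_sum fun j _ => hle q hq j⟩, fun q hq => ?_⟩
  have heq : ∑ j, p j = ∑ j, q j :=
    le_antisymm (sum_le_sum fun j _ => hle q hq.1 j) (hq.2 p hfeas)
  exact funext fun j => ((sum_eq_sum_iff_of_le fun j _ => hle q hq.1 j).1 heq j (mem_univ j)).symm

end LinearPrograms

end FairDivision

/-! ### The main theorem. -/

theorem mainTheorem3 {n m : ℕ} (v : Fin n → Fin m → ℝ) (hv : ∃ i j, v i j ≠ 0)
    (ε : ℝ) (hε_pos : 0 < ε) (hε_lt : ε < FairDivision.lam v / (2 * (m : ℝ)))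
    (e : Fin n → Fin m → ℝ) (he : ∀ i j, e i j ∈ Set.Icc 0 ε)
    (he_zero : ∀ i j, v i j = 0 → e i j = 0) :
    ∃ w ∈ stdSimplex ℝ (Fin n), ∃ p : Fin (m + 1) → ℝ,
      FairDivision.IsDualOptimal (FairDivision.perturbed v e) w (FairDivision.eta v e) p ∧
      (∀ q, FairDivision.IsDualOptimal (FairDivision.perturbed v e) w
        (FairDivision.eta v e) q → q = p) ∧
      (∀ j, IsGreatest
        (Set.range fun i => (w i + FairDivision.eta v e) * FairDivision.perturbed v e i j) (p j)) ∧
      ∀ i, ∃ A : Fin n → Finset (Fin (m + 1)),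
        FairDivision.IsAllocation A ∧
        FairDivision.IsLPOptimal (FairDivision.perturbed v e) w (FairDivision.eta v e)
          (FairDivision.indicatorPoint A) ∧
        ∀ k, FairDivision.bundleSum p (A k) ≤ FairDivision.bundleSum p (A i) := by
  obtain ⟨i₀, j₀, -⟩ := hv
  have : Nonempty (Fin n) := ⟨i₀⟩
  have hn : 0 < n := i₀.pos
  have hm : 0 < m := j₀.pos
  have hm' : (0 : ℝ) < m := by exact_mod_cast hm
  have hn' : (0 : ℝ) < n := by exact_mod_cast hn
  have hL : 0 < FairDivision.lam v :=
    (div_pos_iff_of_pos_right (by positivity)).1 (hε_pos.trans hε_lt)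
  have hlast : ∀ i, FairDivision.perturbed v e i (Fin.last m) = FairDivision.lam v / 2 :=
    fun i => Fin.snoc_last (α := fun _ => ℝ) _ _
  have hle : ∀ i j, |FairDivision.perturbed v e i j| ≤
      ⨆ q : Fin n × Fin (m + 1), |FairDivision.perturbed v e q.1 q.2| := fun i j =>
    le_ciSup (f := fun q : Fin n × Fin (m + 1) => |FairDivision.perturbed v e q.1 q.2|)
      (Set.finite_range _).bddAbove (i, j)
  have hsup : 0 < ⨆ q : Fin n × Fin (m + 1), |FairDivision.perturbed v e q.1 q.2| := by
    refine lt_of_lt_of_le ?_ (hle i₀ (Fin.last m))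
    rw [hlast]
    positivity
  have hη : 0 < FairDivision.eta v e := by
    unfold FairDivision.eta
    positivity
  have hbound : ∀ i j, FairDivision.eta v e * |FairDivision.perturbed v e i j| ≤
      FairDivision.lam v / (2 * m * n) := fun i j => by
    refine (mul_le_mul_of_nonneg_left (hle i j) hη.le).trans_eq ?_
    unfold FairDivision.eta
    field_simp
  obtain ⟨w, hw, hwA⟩ := FairDivision.exists_forall_mem_maxPriceRegion fun w hw A i =>
    FairDivision.weight_ne_zero_of_mem_maxPriceRegion hm hn hL hη hlast hbound hw
  choose A hA using hwA
  have hgreatest : ∀ i j, IsGreatest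
      (Set.range fun i => (w i + FairDivision.eta v e) * FairDivision.perturbed v e i j)
      (FairDivision.assignmentPrice (FairDivision.perturbed v e) (FairDivision.eta v e) (A i) w j) :=
    fun i j => ⟨⟨A i j, rfl⟩, by rintro _ ⟨l, rfl⟩; exact (hA i).1 j l⟩
  obtain ⟨hdual, huniq⟩ := FairDivision.isDualOptimal_of_isGreatest (hgreatest i₀)
  refine ⟨w, hw, _, hdual, huniq, hgreatest i₀, fun i => ⟨_, FairDivision.isAllocation_fibers (A i),
    FairDivision.isLPOptimal_fibers fun l j => (hA i).1 j l, fun k => ?_⟩⟩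
  -- The assignments of different agents may differ, but at `w` they all induce the same prices, the
  -- itemwise maxima.
  rw [show FairDivision.assignmentPrice (FairDivision.perturbed v e) (FairDivision.eta v e)
      (A i₀) w = FairDivision.assignmentPrice _ _ (A i) w from
    funext fun j => (hgreatest i₀ j).unique (hgreatest i j)]
  exact (hA i).2 k
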